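/- Let $\Gamma$ be a totally ordered abelian group with positive cone $\Gamma^+=\{x\in\Gamma: x\ge 0\}$, let $\mathcal A$ be a unital $C^*$-algebra and let $\alpha$ be an action of $\Gamma^+$ on $\mathcal A$ by $*$-endomorphisms (so $\alpha_0=\mathrm{Id}$ and $\alpha_x\circ\alpha_y=\alpha_{x+y}$). Suppose that $(\mathcal A,\Gamma^+,\alpha)$ is finely representable: there are a Hilbert space $H$, a faithful non-degenerate representation $\pi:\mathcal A\to L(H)$ and a semigroup homomorphism $U:\Gamma^+\to L(H)$ such that for all $a\in\mathcal A$, $x\in\Gamma^+$ $$\pi(\alpha_x(a))=U_x\pi(a)U_x^*,\qquad U_x^*\pi(a)U_x\in\pi(\mathcal A),\qquad U_x\pi(a)=\pi(\alpha_x(a))U_x .$$ Let $L$ be the unique complete transfer action of this system, i.e. the unique family of continuous linear positive maps $L_x:\mathcal A\to\mathcal A$ ($x\in\Gamma^+$) with $L_{x+y}=L_y\circ L_x$, $L_x(\alpha_x(a)b)=aL_x(b)$ and $\alpha_x(L_x(a))=\alpha_x(1)a\alpha_x(1)$. Let $l_1(\Gamma,\alpha,\mathcal A)$ be the Banach $*$-algebra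 of families $a=\{a_g\}_{g\in\Gamma}$ with $a_x\in\mathcal A\alpha_x(1)$ and $a_{-x}\in\alpha_x(1)\mathcal A$ for $x\ge 0$, and $\|a\|=\sum_g\|a_g\|<\infty$, with coordinatewise linear operations, involution $(a^*)_g=(a_{-g})^*$, and the continuous bilinear product for which $a\delta_g\cdot b\delta_h=c\,\delta_{g+h}$, where ($a\delta_g$ being the family with the only coefficient $a$, at $g$) * $c=a\alpha_{g+h}(b)$ if $g>0>h$, $g+h\ge0$, and $c=\alpha_{-g-h}(a)b$ if $g>0>h$, $g+h<0$; * $c=L_{-g}(ab)$ if $g<0<h$, $g+h\ge0$, and $c=L_{h}(ab)$ if $g<0<h$, $g+h<0$; * $c=a\alpha_g(b)$ if $g,h\ge0$, and $c=\alpha_{-h}(a)b$ if $g,h\le 0$. Let the crossed product $\mathcal A\rtimes_\alpha\Gamma$ be the enveloping $C^*$-algebra of $l_1(\Gamma,\alpha,\mathcal A)$. Identify $a\in\mathcal A$ with the element of $\mathcal A\rtimes_\alpha\Gamma$ corresponding to $a\delta_0$, and for $x\in\Gamma^+$ let $u_x$ and $u_{-x}$ be the elements corresponding to $\alpha_x(1)\delta_x$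 and $\alpha_x(1)\delta_{-x}$. Consider $\Gamma$ as a discrete group, and let $\hat\Gamma$ be its (compact) dual group, i.e. the group of all characters $\lambda:\Gamma\to\mathbb T$. Then $\hat\Gamma$ acts on $\mathcal A\rtimes_\alpha\Gamma$ by $*$-automorphisms given by $$\lambda a=a\quad(a\in\mathcal A),\qquad \lambda u_g=\lambda(g)\,u_g\quad(g\in\Gamma),\qquad \lambda\in\hat\Gamma .$$ That is, for each $\lambda\in\hat\Gamma$ there is exactly one $*$-automorphism of $\mathcal A\rtimes_\alpha\Gamma$ satisfying these formulas, these automorphisms form a group homomorphism $\hat\Gamma\to\mathrm{Aut}(\mathcal A\rtimes_\alpha\Gamma)$, and $\lambda\mapsto\lambda b$ is norm continuous on $\hat\Gamma$ for every $b\in\mathcal A\rtimes_\alpha\Gamma$. -/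

import Mathlib

open scoped ENNReal

universe u v

noncomputable section

/-- The positive cone `Γ⁺ = {x ∈ Γ : 0 ≤ x}` of an ordered abelian group (an additive monoid). -/
abbrev PosCone (Γ : Type v) [AddCommGroup Γ] [LinearOrder Γ] [IsOrderedAddMonoid Γ] : Type v :=
  {x : Γ // 0 ≤ x}

/-- `|g|` as an element of `Γ⁺`: it is `g` for `0 ≤ g` and `-g` for `g ≤ 0`. -/
def PosCone.abs {Γ : Type v} [AddCommGroup Γ] [LinearOrder Γ] [IsOrderedAddMonoid Γ] (g : Γ) :
    PosCone Γ :=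
  ⟨|g|, abs_nonneg g⟩

/-- An action `α : Γ⁺ → End(A)` by (not necessarily unital) `*`-endomorphisms of the unital
C*-algebra `A`, that is, a C*-dynamical system `(A, Γ⁺, α)`. -/
structure EndoAction (Γ : Type v) [AddCommGroup Γ] [LinearOrder Γ] [IsOrderedAddMonoid Γ]
    (A : Type u) [CStarAlgebra A] where
  /-- the endomorphism `α_x` -/
  endo : PosCone Γ → (A →⋆ₙₐ[ℂ] A)
  endo_zero : ∀ a : A, endo 0 a = a
  endo_add : ∀ (x y : PosCone Γ) (a : A), endo (x + y) a = endo x (endo y a)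

/-- `L` is a complete transfer action for `(A, Γ⁺, α)`: an action of `Γ⁺` by continuous linear
positive maps such that `L_x(α_x(a) b) = a L_x(b)` and `α_x(L_x(a)) = α_x(1) a α_x(1)`. Positive
elements of a C*-algebra are written as `b* b`. -/
structure IsCompleteTransferAction {Γ : Type v} [AddCommGroup Γ] [LinearOrder Γ]
    [IsOrderedAddMonoid Γ] {A : Type u} [CStarAlgebra A] (α : EndoAction Γ A)
    (L : PosCone Γ → (A →L[ℂ] A)) : Prop where
  positive : ∀ (x : PosCone Γ) (a : A), ∃ b : A, L x (star a * a) = star b * b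
  add : ∀ (x y : PosCone Γ) (a : A), L (x + y) a = L y (L x a)
  transfer : ∀ (x : PosCone Γ) (a b : A), L x (α.endo x a * b) = a * L x b
  complete : ∀ (x : PosCone Γ) (a : A), α.endo x (L x a) = α.endo x 1 * a * α.endo x 1

/-- The conditions on a triple `(H, π, U)` in the definition of a finely representable system:
`π` is a faithful non-degenerate (that is, unital) representation of `A` on `H`, and `U` is a
semigroup homomorphism from `Γ⁺` to the bounded operators on `H` with
`π(α_x(a)) = U_x π(a) U_x*`, `U_x* π(a) U_x ∈ π(A)`, `U_x π(a) = π(α_x(a)) U_x`. -/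
structure EndoAction.IsFineRep {Γ : Type v} [AddCommGroup Γ] [LinearOrder Γ]
    [IsOrderedAddMonoid Γ] {A : Type u} [CStarAlgebra A] (α : EndoAction Γ A)
    {H : Type*} [NormedAddCommGroup H] [InnerProductSpace ℂ H] [CompleteSpace H]
    (π : A →⋆ₐ[ℂ] (H →L[ℂ] H)) (U : PosCone Γ → (H →L[ℂ] H)) : Prop where
  faithful : Function.Injective π
  U_zero : U 0 = 1
  U_add : ∀ x y : PosCone Γ, U (x + y) = U x * U y
  covariant : ∀ (x : PosCone Γ) (a : A), π (α.endo x a) = U x * π a * star (U x)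
  star_mem : ∀ (x : PosCone Γ) (a : A), ∃ b : A, star (U x) * π a * U x = π b
  intertwine : ∀ (x : PosCone Γ) (a : A), U x * π a = π (α.endo x a) * U x

/-- The system `(A, Γ⁺, α)` is finely representable. (By the Gelfand-Naimark-Segal construction the
choice of the universe of `H` is no restriction.) -/
def EndoAction.FinelyRepresentable {Γ : Type v} [AddCommGroup Γ] [LinearOrder Γ]
    [IsOrderedAddMonoid Γ] {A : Type u} [CStarAlgebra A] (α : EndoAction Γ A) : Prop :=
  ∃ (H : Type (max u v)) (_ : NormedAddCommGroup H) (_ : InnerProductSpace ℂ H)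
    (_ : CompleteSpace H) (π : A →⋆ₐ[ℂ] (H →L[ℂ] H)) (U : PosCone Γ → (H →L[ℂ] H)),
    α.IsFineRep π U

section Transfer

variable {Γ : Type v} [AddCommGroup Γ] [LinearOrder Γ] [IsOrderedAddMonoid Γ]
  {A : Type u} [CStarAlgebra A] {α : EndoAction Γ A}

/-- An element of a C*-algebra whose image under a faithful representation is of the form `T* T`
is itself of the form `b* b`. -/
theorem exists_star_mul_self_of_map {H : Type*} [NormedAddCommGroup H] [InnerProductSpace ℂ H]
    [CompleteSpace H] (π : A →⋆ₐ[ℂ] (H →L[ℂ] H)) (hπ : Function.Injective π) (c : A)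
    (T : H →L[ℂ] H) (hT : π c = star T * T) : ∃ b : A, c = star b * b := by
  let _ := CStarAlgebra.spectralOrder A
  have _ := CStarAlgebra.spectralOrderedRing A
  have hsa : IsSelfAdjoint c := by
    apply hπ
    rw [map_star, hT]
    simp
  have hpos : (0 : H →L[ℂ] H) ≤ π c := by
    rw [hT]; exact star_mul_self_nonneg T
  have hcont : Continuous π := (NonUnitalStarAlgHom.isometry π hπ).continuous
  have hneg : c⁻ = 0 := by
    apply hπ
    have h1 : π (c⁻) = (π c)⁻ := by
      rw [CFC.negPart_def, CFC.negPart_def]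
      exact NonUnitalStarAlgHomClass.map_cfcₙ π _ c (hφ := hcont)
    rw [h1, map_zero]
    exact (CFC.negPart_eq_zero_iff _ (hsa.map π)).2 hpos
  have h0 : 0 ≤ c := (CFC.negPart_eq_zero_iff _ hsa).1 hneg
  exact (CStarAlgebra.nonneg_iff_eq_star_mul_self).1 h0

/-- The operators `U_x` of a fine representation are contractions. -/
theorem EndoAction.IsFineRep.norm_le {H : Type*} [NormedAddCommGroup H] [InnerProductSpace ℂ H]
    [CompleteSpace H] {π : A →⋆ₐ[ℂ] (H →L[ℂ] H)} {U : PosCone Γ → (H →L[ℂ] H)}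
    (h : α.IsFineRep π U) (x : PosCone Γ) : ‖U x‖ ≤ 1 := by
  have h1 : U x * star (U x) = π (α.endo x 1) := by rw [h.covariant]; simp
  have h2 : ‖U x‖ * ‖U x‖ ≤ 1 := by
    rw [← CStarRing.norm_self_mul_star, h1]
    refine (NonUnitalStarAlgHom.norm_apply_le π _).trans
      ((NonUnitalStarAlgHom.norm_apply_le (α.endo x) _).trans ?_)
    nontriviality A
    simp
  nlinarith [norm_nonneg (U x)]

/-- A fine representation implements a complete transfer action by `U_x* π(a) U_x`. -/
theorem EndoAction.IsFineRep.exists_transfer {H : Type*} [NormedAddCommGroup H]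
    [InnerProductSpace ℂ H] [CompleteSpace H] {π : A →⋆ₐ[ℂ] (H →L[ℂ] H)}
    {U : PosCone Γ → (H →L[ℂ] H)} (h : α.IsFineRep π U) :
    ∃ L : PosCone Γ → (A →L[ℂ] A), IsCompleteTransferAction α L ∧
      ∀ x a, π (L x a) = star (U x) * π a * U x := by
  choose l hl using h.star_mem
  have hlin : ∀ x a, ‖l x a‖ ≤ 1 * ‖a‖ := by
    intro x a
    rw [← NonUnitalStarAlgHom.norm_map π h.faithful, ← hl]
    have hU := h.norm_le x
    have ha := NonUnitalStarAlgHom.norm_apply_le π a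
    calc ‖star (U x) * π a * U x‖ ≤ ‖star (U x)‖ * ‖π a‖ * ‖U x‖ :=
          (norm_mul_le _ _).trans (by gcongr; exact norm_mul_le _ _)
      _ ≤ 1 * ‖a‖ * 1 := by rw [norm_star]; gcongr
      _ = 1 * ‖a‖ := by ring
  let L : PosCone Γ → (A →L[ℂ] A) := fun x => LinearMap.mkContinuous
    { toFun := l x
      map_add' := fun a b => h.faithful (by
        rw [map_add, ← hl, ← hl, ← hl, map_add, mul_add, add_mul])
      map_smul' := fun c a => h.faithful (by
        rw [RingHom.id_apply, map_smul, ← hl, ← hl, map_smul, mul_smul_comm, smul_mul_assoc]) }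
    1 (hlin x)
  have hL : ∀ x a, π (L x a) = star (U x) * π a * U x := fun x a => (hl x a).symm
  refine ⟨L, ⟨fun x a => ?_, fun x y a => ?_, fun x a b => ?_, fun x a => ?_⟩, hL⟩
  · refine exists_star_mul_self_of_map π h.faithful _ (π a * U x) ?_
    rw [hL, map_mul, map_star, star_mul]
    simp only [mul_assoc]
  · apply h.faithful
    rw [hL, hL, hL, h.U_add, star_mul]
    simp only [mul_assoc]
  · apply h.faithful
    have h3 : star (U x) * π (α.endo x a) = π a * star (U x) := by
      have := congrArg star (h.intertwine x (star a))
      rw [star_mul, star_mul, ← map_star, ← map_star, ← map_star, star_star] at this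
      exact this.symm
    rw [hL, map_mul, map_mul, hL, ← mul_assoc, h3]
    simp only [mul_assoc]
  · apply h.faithful
    rw [h.covariant, hL, map_mul, map_mul, h.covariant, map_one]
    simp only [mul_assoc, mul_one]

/-- A complete transfer action is `*`-preserving. -/
theorem IsCompleteTransferAction.apply_star {L : PosCone Γ → (A →L[ℂ] A)}
    (h : IsCompleteTransferAction α L) (x : PosCone Γ) (a : A) :
    L x (star a) = star (L x a) := by
  -- polarization of the positivity
  have hp : ∀ b : A, star (L x (star b * b)) = L x (star b * b) := by
    intro b
    obtain ⟨c, hc⟩ := h.positive x b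
    rw [hc]; simp
  have h1 := hp (1 + a)
  have h2 := hp (1 + Complex.I • a)
  have h3 := hp a
  have h4 := hp 1
  simp only [star_add, star_one, add_mul, mul_add, one_mul, mul_one, map_add, star_smul,
    smul_mul_assoc, mul_smul_comm, map_smul] at h1 h2 h3 h4
  simp only [Complex.star_def, Complex.conj_I, Complex.conj_conj, neg_mul, mul_neg,
    Complex.I_mul_I, neg_neg, one_smul, h3, h4, neg_smul, smul_neg, star_neg] at h1 h2
  set p := L x (star a)
  set q := L x a
  have e1 : star p + star q = p + q := by
    have : star p + star q + (L x 1 + L x (star a * a)) = p + q + (L x 1 + L x (star a * a)) := by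
      linear_combination (norm := module) h1
    exact add_right_cancel this
  have e2 : Complex.I • (star p - star q) = Complex.I • (q - p) := by
    rw [smul_sub, smul_sub]
    linear_combination (norm := module) h2
  have e3 : star p - star q = q - p := by
    have := congrArg (fun z => (-Complex.I) • z) e2
    simpa [smul_smul] using this
  have e4 : (2 : ℂ) • star q = (2 : ℂ) • p := by
    rw [two_smul, two_smul]
    linear_combination (norm := module) e1 - e3
  exact ((smul_right_injective A (two_ne_zero' ℂ)) e4).symm

theorem IsCompleteTransferAction.transfer_right {L : PosCone Γ → (A →L[ℂ] A)}
    (h : IsCompleteTransferAction α L) (x : PosCone Γ) (a b : A) :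
    L x (b * α.endo x a) = L x b * a := by
  have := congrArg star (h.transfer x (star a) (star b))
  rw [← h.apply_star, star_mul, star_mul, star_star, ← map_star, star_star, h.apply_star,
    star_star] at this
  exact this

/-- A complete transfer action is unique. -/
theorem IsCompleteTransferAction.unique {L L' : PosCone Γ → (A →L[ℂ] A)}
    (h : IsCompleteTransferAction α L) (h' : IsCompleteTransferAction α L') : L = L' := by
  -- `M_x ∘ α_x ∘ N_x = M_x` for any two complete transfer actions
  have key : ∀ {M N : PosCone Γ → (A →L[ℂ] A)}, IsCompleteTransferAction α M →
      IsCompleteTransferAction α N → ∀ x a, M x a = N x a * M x 1 := by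
    intro M N hM hN x a
    have h1 := hM.transfer x (N x a) 1
    rw [mul_one, hN.complete, hM.transfer_right, mul_one, hM.transfer, one_mul] at h1
    exact h1
  have hc : ∀ {M : PosCone Γ → (A →L[ℂ] A)}, IsCompleteTransferAction α M → ∀ x a,
      M x 1 * a = a * M x 1 := by
    intro M hM x a
    have h1 := hM.transfer x a 1
    have h2 := hM.transfer_right x a 1
    rw [mul_one] at h1
    rw [one_mul] at h2
    rw [← h1, ← h2]
  funext x
  ext a
  have e : L x 1 = L' x 1 := by
    rw [key h h' x 1, ← hc h, ← key h' h x 1]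
  rw [key h h' x a, e, ← key h' h' x a]

theorem EndoAction.FinelyRepresentable.existsUnique_transfer (hα : α.FinelyRepresentable) :
    ∃! L : PosCone Γ → (A →L[ℂ] A), IsCompleteTransferAction α L := by
  obtain ⟨H, _, _, _, π, U, h⟩ := hα
  obtain ⟨L, hL, -⟩ := h.exists_transfer
  exact ⟨L, hL, fun L' hL' => hL'.unique hL⟩

/-- The unique complete transfer action `L` of a finely representable system. -/
def EndoAction.FinelyRepresentable.transfer (hα : α.FinelyRepresentable) :
    PosCone Γ → (A →L[ℂ] A) :=
  hα.existsUnique_transfer.choose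

theorem EndoAction.FinelyRepresentable.transfer_spec (hα : α.FinelyRepresentable) :
    IsCompleteTransferAction α hα.transfer :=
  hα.existsUnique_transfer.choose_spec.1

theorem EndoAction.FinelyRepresentable.norm_transfer_le (hα : α.FinelyRepresentable)
    (x : PosCone Γ) (a : A) : ‖hα.transfer x a‖ ≤ ‖a‖ := by
  have hs := hα.transfer_spec
  obtain ⟨H, _, _, _, π, U, h⟩ := id hα
  obtain ⟨L, hL, hπ⟩ := h.exists_transfer
  rw [hs.unique hL, ← NonUnitalStarAlgHom.norm_map π h.faithful, hπ]
  have hU := h.norm_le x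
  have ha := NonUnitalStarAlgHom.norm_apply_le π a
  calc ‖star (U x) * π a * U x‖ ≤ ‖star (U x)‖ * ‖π a‖ * ‖U x‖ :=
        (norm_mul_le _ _).trans (by gcongr; exact norm_mul_le _ _)
    _ ≤ 1 * ‖a‖ * 1 := by rw [norm_star]; gcongr
    _ = ‖a‖ := by ring

end Transfer

section L1

variable {Γ : Type v} [AddCommGroup Γ] [LinearOrder Γ] [IsOrderedAddMonoid Γ]
  {A : Type u} [CStarAlgebra A] {α : EndoAction Γ A}

/-- The possible coefficients at `g`: the subspace `A α_g(1)` of `A` if `0 ≤ g`, and `α_{-g}(1) A`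
if `g ≤ 0`. As `p = α_{|g|}(1)` is a projection, `a ∈ A p` means `a p = a`. -/
def EndoAction.fiber (α : EndoAction Γ A) (g : Γ) : Submodule ℂ A where
  carrier := {a | (0 ≤ g → a * α.endo (PosCone.abs g) 1 = a) ∧
    (g ≤ 0 → α.endo (PosCone.abs g) 1 * a = a)}
  add_mem' {a b} ha hb := ⟨fun h => by rw [add_mul, ha.1 h, hb.1 h],
    fun h => by rw [mul_add, ha.2 h, hb.2 h]⟩
  zero_mem' := ⟨fun _ => zero_mul _, fun _ => mul_zero _⟩
  smul_mem' c a ha := ⟨fun h => by rw [smul_mul_assoc, ha.1 h],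
    fun h => by rw [mul_smul_comm, ha.2 h]⟩

/-- The families `(a_g)` with `∑ ‖a_g‖ < ∞` and `a_g ∈ A α_g(1)` for `0 ≤ g`, `a_g ∈ α_{-g}(1) A`
for `g ≤ 0`, as a subspace of the Banach space of all absolutely summable families in `A`. -/
def EndoAction.l1Submodule (α : EndoAction Γ A) : Submodule ℂ (lp (fun _ : Γ => A) 1) where
  carrier := {f | ∀ g, f g ∈ α.fiber g}
  add_mem' {f f'} hf hf' g := (α.fiber g).add_mem (hf g) (hf' g)
  zero_mem' g := (α.fiber g).zero_mem
  smul_mem' c f hf g := (α.fiber g).smul_mem c (hf g)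

/-- The algebra `ℓ₁(Γ, α, A)` of a finely representable system: its Banach space structure is that
of `EndoAction.l1Submodule`, with the norm `∑ ‖a_g‖`; product and involution are given below. -/
def L1Alg (_hα : α.FinelyRepresentable) : Type (max u v) := α.l1Submodule

namespace L1Alg

variable {hα : α.FinelyRepresentable}

instance : NormedAddCommGroup (L1Alg hα) := inferInstanceAs (NormedAddCommGroup α.l1Submodule)

instance : NormedSpace ℂ (L1Alg hα) := inferInstanceAs (NormedSpace ℂ α.l1Submodule)

/-- The coefficient `a_g` of `a ∈ ℓ₁(Γ, α, A)`. -/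
def coeff (a : L1Alg hα) (g : Γ) : A := a.1 g

theorem coeff_mem (a : L1Alg hα) (g : Γ) : a.coeff g ∈ α.fiber g := a.2 g

theorem coeff_add (a b : L1Alg hα) (g : Γ) : (a + b).coeff g = a.coeff g + b.coeff g := rfl

theorem coeff_zero (g : Γ) : (0 : L1Alg hα).coeff g = 0 := rfl

theorem ext {a b : L1Alg hα} (h : ∀ g, a.coeff g = b.coeff g) : a = b :=
  Subtype.ext (lp.ext (funext h))

theorem summable_norm_coeff (a : L1Alg hα) : Summable fun g => ‖a.coeff g‖ := by
  simpa using! (lp.memℓp a.1).summable (by simp)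

/-- The element of `ℓ₁(Γ, α, A)` with given absolutely summable coefficients. -/
def mk (f : Γ → A) (hf : Summable fun g => ‖f g‖) (hf' : ∀ g, f g ∈ α.fiber g) : L1Alg hα :=
  ⟨⟨f, memℓp_gen (by simpa using hf)⟩, hf'⟩

theorem coeff_mk (f : Γ → A) (hf : Summable fun g => ‖f g‖) (hf' : ∀ g, f g ∈ α.fiber g) (g : Γ) :
    (mk f hf hf' : L1Alg hα).coeff g = f g := rfl

end L1Alg

theorem PosCone.abs_neg {g : Γ} : PosCone.abs (-g) = PosCone.abs g :=
  Subtype.ext (_root_.abs_neg g)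

theorem EndoAction.star_mem_fiber {g : Γ} {a : A} (ha : a ∈ α.fiber g) :
    star a ∈ α.fiber (-g) := by
  refine ⟨fun h => ?_, fun h => ?_⟩
  · have := congrArg star (ha.2 (by simpa using h))
    rwa [star_mul, ← map_star, star_one, ← PosCone.abs_neg] at this
  · have := congrArg star (ha.1 (by simpa using h))
    rwa [star_mul, ← map_star, star_one, ← PosCone.abs_neg] at this

/-- The involution `(a*)_g = (a_{-g})*`. -/
instance L1Alg.instStar {hα : α.FinelyRepresentable} : Star (L1Alg hα) where
  star a := .mk (fun g => star (a.coeff (-g)))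
    (by simpa using! ((Equiv.neg Γ).summable_iff.2 a.summable_norm_coeff))
    (fun g => by simpa using EndoAction.star_mem_fiber (a.coeff_mem (-g)))

/-- The coefficient of the product `(a δ_g) (b δ_h)` at `g + h`:
* `a α_{g+h}(b)` or `α_{-(g+h)}(a) b` if `g > 0 > h`, according to the sign of `g + h`;
* `L_{-g}(a b)` or `L_h(a b)` if `g < 0 < h`, according to the sign of `g + h`;
* `a α_g(b)` if `g, h ≥ 0`, and `α_{-h}(a) b` if `g, h ≤ 0`. -/
def EndoAction.FinelyRepresentable.homMul (hα : α.FinelyRepresentable) (g h : Γ) (a b : A) : A :=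
  if 0 < g ∧ h < 0 then
    if 0 ≤ g + h then a * α.endo (PosCone.abs (g + h)) b
    else α.endo (PosCone.abs (g + h)) a * b
  else if g < 0 ∧ 0 < h then
    if 0 ≤ g + h then hα.transfer (PosCone.abs g) (a * b)
    else hα.transfer (PosCone.abs h) (a * b)
  else
    if 0 ≤ g + h then a * α.endo (PosCone.abs g) b
    else α.endo (PosCone.abs h) a * b

namespace EndoAction.FinelyRepresentable

variable (hα : α.FinelyRepresentable)

theorem homMul_add (g h : Γ) (a b c : A) :
    hα.homMul g h a (b + c) = hα.homMul g h a b + hα.homMul g h a c := by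
  unfold homMul
  split_ifs <;> simp only [mul_add, map_add]

theorem add_homMul (g h : Γ) (a b c : A) :
    hα.homMul g h (a + b) c = hα.homMul g h a c + hα.homMul g h b c := by
  unfold homMul
  split_ifs <;> simp only [add_mul, map_add]

theorem norm_homMul_le (g h : Γ) (a b : A) : ‖hα.homMul g h a b‖ ≤ ‖a‖ * ‖b‖ := by
  have hα' : ∀ (x : PosCone Γ) (a : A), ‖α.endo x a‖ ≤ ‖a‖ := fun x a =>
    NonUnitalStarAlgHom.norm_apply_le _ _
  unfold homMul
  split_ifs
  all_goals first
    | exact (norm_mul_le _ _).trans (by gcongr; exact hα' _ _)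
    | exact (hα.norm_transfer_le _ _).trans (norm_mul_le _ _)

theorem homMul_mem (g h : Γ) {a b : A} (ha : a ∈ α.fiber g) (hb : b ∈ α.fiber h) :
    hα.homMul g h a b ∈ α.fiber (g + h) := by
  have hs := hα.transfer_spec
  have e : ∀ {x y z : PosCone Γ} (c : A), (z : Γ) = x + y →
      α.endo x (α.endo y c) = α.endo z c := by
    intro x y z c hz
    rw [← α.endo_add, show z = x + y from Subtype.ext hz]
  have em : ∀ (x : PosCone Γ) (c : A), α.endo x c * α.endo x 1 = α.endo x c := by
    intro x c; rw [← map_mul, mul_one]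
  have em' : ∀ (x : PosCone Γ) (c : A), α.endo x 1 * α.endo x c = α.endo x c := by
    intro x c; rw [← map_mul, one_mul]
  have e0 : ∀ {x : PosCone Γ} (c : A), (x : Γ) = 0 → α.endo x c = c := by
    intro x c hx
    rw [show x = 0 from Subtype.ext hx, α.endo_zero]
  unfold homMul
  split_ifs with h1 h2 h3 h4 h5
  · refine ⟨fun _ => by rw [mul_assoc, em], fun h6 => ?_⟩
    rw [e0 1 (by simp [PosCone.abs, le_antisymm h6 h2]), one_mul]
  · refine ⟨fun h6 => absurd h6 h2, fun _ => by rw [← mul_assoc, em']⟩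
  · have key : hα.transfer (PosCone.abs g) (a * b) * α.endo (PosCone.abs (g + h)) 1 =
        hα.transfer (PosCone.abs g) (a * b) := by
      rw [← hs.transfer_right, e (z := PosCone.abs h), mul_assoc, hb.1 h3.2.le]
      simp only [PosCone.abs, abs_of_neg h3.1, abs_of_pos h3.2, abs_of_nonneg h4]
      abel
    refine ⟨fun _ => key, fun h6 => ?_⟩
    rw [e0 1 (by simp [PosCone.abs, le_antisymm h6 h4]), one_mul]
  · have key : α.endo (PosCone.abs (g + h)) 1 * hα.transfer (PosCone.abs h) (a * b) =
        hα.transfer (PosCone.abs h) (a * b) := by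
      rw [← hs.transfer, e (z := PosCone.abs g), ← mul_assoc, ha.2 h3.1.le]
      simp only [PosCone.abs, abs_of_neg h3.1, abs_of_pos h3.2, abs_of_neg (not_le.1 h4)]
      abel
    exact ⟨fun h6 => absurd h6 h4, fun _ => key⟩
  · have hg : 0 ≤ g := by
      by_contra hg
      rw [not_le] at hg
      rcases lt_or_ge 0 h with hh | hh
      · exact h3 ⟨hg, hh⟩
      · exact absurd (add_neg_of_neg_of_nonpos hg hh) (not_lt.2 h5)
    have hh : 0 ≤ h := by
      by_contra hh
      rw [not_le] at hh
      rcases hg.lt_or_eq with hg' | hg'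
      · exact h1 ⟨hg', hh⟩
      · rw [← hg', zero_add] at h5; exact absurd h5 (not_le.2 hh)
    refine ⟨fun _ => ?_, fun h6 => ?_⟩
    · rw [mul_assoc, ← e (x := PosCone.abs g) (y := PosCone.abs h) (z := PosCone.abs (g + h)) 1,
        ← map_mul, hb.1 hh]
      simp only [PosCone.abs, abs_of_nonneg hg, abs_of_nonneg hh, abs_of_nonneg h5]
    · rw [e0 1 (by simp [PosCone.abs, le_antisymm h6 h5]), one_mul]
  · rw [not_le] at h5
    have hg : g ≤ 0 := by
      by_contra hg
      rw [not_le] at hg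
      rcases lt_or_ge h 0 with hh | hh
      · exact h1 ⟨hg, hh⟩
      · exact absurd (add_pos_of_pos_of_nonneg hg hh) (not_lt.2 h5.le)
    have hh : h ≤ 0 := by
      by_contra hh
      rw [not_le] at hh
      rcases hg.lt_or_eq with hg' | hg'
      · exact h3 ⟨hg', hh⟩
      · rw [hg', zero_add] at h5; exact absurd h5 (not_lt.2 hh.le)
    refine ⟨fun h6 => absurd h6 (not_le.2 h5), fun _ => ?_⟩
    rw [← mul_assoc, ← e (x := PosCone.abs h) (y := PosCone.abs g) (z := PosCone.abs (g + h)) 1,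
      ← map_mul, ha.2 hg]
    simp only [PosCone.abs, abs_of_nonpos hg, abs_of_nonpos hh, abs_of_neg h5]
    abel

end EndoAction.FinelyRepresentable

namespace L1Alg

variable {hα : α.FinelyRepresentable}

theorem summable_prod (a b : L1Alg hα) :
    Summable fun p : Γ × Γ => ‖a.coeff p.2‖ * ‖b.coeff (p.1 - p.2)‖ := by
  have h := a.summable_norm_coeff.mul_of_nonneg b.summable_norm_coeff
    (fun _ => norm_nonneg _) (fun _ => norm_nonneg _)
  let e : Γ × Γ ≃ Γ × Γ :=
    { toFun := fun p => (p.2, p.1 - p.2)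
      invFun := fun q => (q.1 + q.2, q.1)
      left_inv := fun p => by simp
      right_inv := fun q => by simp }
  exact (e.summable_iff).2 h

theorem summable_homMul_norm (a b : L1Alg hα) (g : Γ) :
    Summable fun h => ‖hα.homMul h (g - h) (a.coeff h) (b.coeff (g - h))‖ :=
  Summable.of_nonneg_of_le (fun _ => norm_nonneg _) (fun _ => hα.norm_homMul_le _ _ _ _)
    ((summable_prod a b).prod_factor g)

theorem summable_homMul (a b : L1Alg hα) (g : Γ) :
    Summable fun h => hα.homMul h (g - h) (a.coeff h) (b.coeff (g - h)) :=
  (summable_homMul_norm a b g).of_norm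

/-- The product of `ℓ₁(Γ, α, A)`: `(a b)_g` is the (absolutely convergent) sum over all
decompositions `g = h + (g - h)` of the coefficients of `(a_h δ_h) (b_{g-h} δ_{g-h})`. -/
instance : Mul (L1Alg hα) where
  mul a b := .mk (fun g => ∑' h, hα.homMul h (g - h) (a.coeff h) (b.coeff (g - h)))
    (Summable.of_nonneg_of_le (fun _ => norm_nonneg _)
      (fun g => (norm_tsum_le_tsum_norm (summable_homMul_norm a b g)).trans
        ((summable_homMul_norm a b g).tsum_le_tsum (fun _ => hα.norm_homMul_le _ _ _ _)
          ((summable_prod a b).prod_factor g)))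
      (summable_prod a b).prod)
    (fun g => by
      have hm : ∀ h, hα.homMul h (g - h) (a.coeff h) (b.coeff (g - h)) ∈ α.fiber g := fun h => by
        have := hα.homMul_mem h (g - h) (a.coeff_mem h) (b.coeff_mem (g - h))
        rwa [add_sub_cancel] at this
      refine ⟨fun hg => ?_, fun hg => ?_⟩
      · rw [← (summable_homMul a b g).tsum_mul_right]
        exact tsum_congr fun h => (hm h).1 hg
      · rw [← (summable_homMul a b g).tsum_mul_left]
        exact tsum_congr fun h => (hm h).2 hg)

theorem coeff_mul (a b : L1Alg hα) (g : Γ) : (a * b).coeff g =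
    ∑' h, hα.homMul h (g - h) (a.coeff h) (b.coeff (g - h)) := rfl

/-- The ring structure of `ℓ₁(Γ, α, A)`. The product is in fact associative; distributivity is all
that is needed in order to speak of `*`-homomorphisms from `ℓ₁(Γ, α, A)`. -/
instance : NonUnitalNonAssocRing (L1Alg hα) where
  left_distrib a b c := ext fun g => by
    simp only [coeff_mul, coeff_add, hα.homMul_add]
    exact (summable_homMul a b g).tsum_add (summable_homMul a c g)
  right_distrib a b c := ext fun g => by
    simp only [coeff_mul, coeff_add, hα.add_homMul]
    exact (summable_homMul a c g).tsum_add (summable_homMul b c g)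
  zero_mul a := by
    have h : (0 : L1Alg hα) * a = 0 * a + 0 * a := ext fun g => by
      simp only [coeff_mul, coeff_add]
      rw [← (summable_homMul 0 a g).tsum_add (summable_homMul 0 a g)]
      simp only [← hα.add_homMul, coeff_zero, add_zero]
    simpa using h
  mul_zero a := by
    have h : a * (0 : L1Alg hα) = a * 0 + a * 0 := ext fun g => by
      simp only [coeff_mul, coeff_add]
      rw [← (summable_homMul a 0 g).tsum_add (summable_homMul a 0 g)]
      simp only [← hα.homMul_add, coeff_zero, add_zero]
    simpa using h

/-- The element `a δ_g` of `ℓ₁(Γ, α, A)`, for `a` in the coefficient space at `g`. -/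
def delta (hα : α.FinelyRepresentable) (g : Γ) (a : α.fiber g) : L1Alg hα :=
  open Classical in
  ⟨lp.single 1 g (a : A), fun h => by
    rw [lp.single_apply]
    by_cases hh : h = g
    · subst hh; simp
    · simp [Pi.single_eq_of_ne hh]⟩

end L1Alg

end L1

section CrossedProduct

variable {Γ : Type v} [AddCommGroup Γ] [LinearOrder Γ] [IsOrderedAddMonoid Γ]
  {A : Type u} [CStarAlgebra A] {α : EndoAction Γ A}

/-- A representation of the Banach `*`-algebra `ℓ₁(Γ, α, A)` on a Hilbert space. (Contractivity,
which is automatic for `*`-homomorphisms from Banach `*`-algebras to C*-algebras, is part of the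
definition. The universe is large enough for every cyclic representation up to equivalence.) -/
structure L1Rep (hα : α.FinelyRepresentable) where
  /-- the Hilbert space -/
  H : Type (max u v)
  [normed : NormedAddCommGroup H]
  [inner : InnerProductSpace ℂ H]
  [complete : CompleteSpace H]
  /-- the `*`-homomorphism -/
  toHom : L1Alg hα →⋆ₙₐ[ℂ] (H →L[ℂ] H)
  norm_le : ∀ a, ‖toHom a‖ ≤ ‖a‖

attribute [instance] L1Rep.normed L1Rep.inner L1Rep.complete

/-- The C*-algebra of all bounded families of operators, indexed by the representations of
`ℓ₁(Γ, α, A)`, with pointwise operations and the supremum norm. -/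
def L1RepProd (hα : α.FinelyRepresentable) : Type (max u v + 1) :=
  lp (fun ρ : L1Rep hα => ρ.H →L[ℂ] ρ.H) ∞

instance (hα : α.FinelyRepresentable) : NonUnitalCStarAlgebra (L1RepProd hα) :=
  inferInstanceAs (NonUnitalCStarAlgebra (lp (fun ρ : L1Rep hα => ρ.H →L[ℂ] ρ.H) ∞))

/-- The direct sum of all the representations of `ℓ₁(Γ, α, A)`. Its norm
`‖a‖ = sup {‖ρ(a)‖ : ρ a representation}` is the enveloping C*-seminorm of `a`. -/
def universalRep (hα : α.FinelyRepresentable) : L1Alg hα →⋆ₙₐ[ℂ] L1RepProd hα where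
  toFun a := ⟨fun ρ => ρ.toHom a, memℓp_infty ⟨‖a‖, by rintro _ ⟨ρ, rfl⟩; exact ρ.norm_le a⟩⟩
  map_smul' c a := lp.ext (funext fun ρ => map_smul ρ.toHom c a)
  map_zero' := lp.ext (funext fun ρ => map_zero ρ.toHom)
  map_add' a b := lp.ext (funext fun ρ => map_add ρ.toHom a b)
  map_mul' a b := lp.ext (funext fun ρ => map_mul ρ.toHom a b)
  map_star' a := lp.ext (funext fun ρ => map_star ρ.toHom a)

/-- The crossed product `A ⋊_α Γ`: the enveloping C*-algebra of `ℓ₁(Γ, α, A)`, realized as the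
closure of the image of `ℓ₁(Γ, α, A)` in its universal representation. -/
def crossedProductSubalgebra (hα : α.FinelyRepresentable) :
    NonUnitalStarSubalgebra ℂ (L1RepProd hα) :=
  (NonUnitalStarAlgHom.range (universalRep hα)).topologicalClosure

/-- The crossed product `A ⋊_α Γ` as a type. -/
def CrossedProduct (hα : α.FinelyRepresentable) : Type (max u v + 1) :=
  crossedProductSubalgebra hα

instance (hα : α.FinelyRepresentable) : NonUnitalCStarAlgebra (CrossedProduct hα) :=
  NonUnitalStarSubalgebra.nonUnitalCStarAlgebra (crossedProductSubalgebra hα)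
    (h_closed := NonUnitalStarSubalgebra.isClosed_topologicalClosure _)

namespace CrossedProduct

/-- The canonical `*`-homomorphism `ℓ₁(Γ, α, A) → A ⋊_α Γ`. -/
def ofL1 (hα : α.FinelyRepresentable) : L1Alg hα →⋆ₙₐ[ℂ] CrossedProduct hα where
  toFun a := ⟨universalRep hα a, subset_closure ⟨a, rfl⟩⟩
  map_smul' c a := Subtype.ext (map_smul (universalRep hα) c a)
  map_zero' := Subtype.ext (map_zero (universalRep hα))
  map_add' a b := Subtype.ext (map_add (universalRep hα) a b)
  map_mul' a b := Subtype.ext (map_mul (universalRep hα) a b)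
  map_star' a := Subtype.ext (map_star (universalRep hα) a)

theorem mem_fiber_zero (a : A) : a ∈ α.fiber 0 := by
  have h0 : α.endo (PosCone.abs (0 : Γ)) 1 = 1 := by
    rw [show PosCone.abs (0 : Γ) = 0 from Subtype.ext abs_zero, α.endo_zero]
  exact ⟨fun _ => by rw [h0, mul_one], fun _ => by rw [h0, one_mul]⟩

theorem endo_one_mem_fiber (g : Γ) : α.endo (PosCone.abs g) 1 ∈ α.fiber g :=
  ⟨fun _ => by rw [← map_mul, mul_one], fun _ => by rw [← map_mul, one_mul]⟩

/-- The element of `A ⋊_α Γ` corresponding to `a ∈ A`, namely the class of `a δ_0`. -/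
def ofBase (hα : α.FinelyRepresentable) (a : A) : CrossedProduct hα :=
  ofL1 hα (L1Alg.delta hα 0 ⟨a, mem_fiber_zero a⟩)

/-- The element `u_g` of `A ⋊_α Γ`: for `x ∈ Γ⁺`, `u_x` is the class of `α_x(1) δ_x` and `u_{-x}`
is the class of `α_x(1) δ_{-x}`. -/
def u (hα : α.FinelyRepresentable) (g : Γ) : CrossedProduct hα :=
  ofL1 hα (L1Alg.delta hα g ⟨α.endo (PosCone.abs g) 1, endo_one_mem_fiber g⟩)

end CrossedProduct

end CrossedProduct

end

noncomputable section

open scoped CStarAlgebra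

section DualAction

variable {Γ : Type v} [AddCommGroup Γ] [LinearOrder Γ] [IsOrderedAddMonoid Γ]
  {A : Type u} [CStarAlgebra A] {α : EndoAction Γ A}

/-! ### Homogeneity of the product of coefficients, and products with degree zero -/

namespace EndoAction.FinelyRepresentable

variable (hα : α.FinelyRepresentable)

/-! The algebra `ℓ₁(Γ, α, A)` is graded by `Γ`: the product of terms of degrees `g` and `h` has
degree `g + h`, and the involution sends degree `g` to `-g`. Multiplying the coefficient at `g` by
`χ(g)` is therefore an isometric `*`-endomorphism (`L1Alg.twist`), because `χ` is multiplicative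
with values of modulus one.

To pass to the enveloping C*-algebra, precompose a representation with this map: the result is again
a contractive representation on the same space. Reindexing a bounded family of operators by this
operation on representations is a `*`-endomorphism of the big product, compatible with the universal
representation, so it preserves the closure of the image (`CrossedProduct.twist`).

The elements `a δ_g` span a dense subspace, on which the twist is the scalar `χ(g)`; the group laws
follow by continuity (`hom_ext`). Uniqueness holds because `a δ_g` is `a u_g` for `g ≥ 0` and `u_g
a` for `g < 0`. Norm continuity holds because the twists are contractions, so that the elements with
continuous orbit map form a closed subspace, and it contains every `a δ_g`. -/

theorem smul_homMul (g h : Γ) (c : ℂ) (a b : A) :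
    hα.homMul g h (c • a) b = c • hα.homMul g h a b := by
  unfold homMul
  split_ifs <;> simp only [smul_mul_assoc, map_smul]

theorem homMul_smul (g h : Γ) (c : ℂ) (a b : A) :
    hα.homMul g h a (c • b) = c • hα.homMul g h a b := by
  unfold homMul
  split_ifs <;> simp only [mul_smul_comm, map_smul]

theorem zero_homMul (g h : Γ) (b : A) : hα.homMul g h 0 b = 0 := by
  simpa using hα.smul_homMul g h 0 0 b

theorem endo_abs_zero (a : A) : α.endo (PosCone.abs (0 : Γ)) a = a := by
  rw [show PosCone.abs (0 : Γ) = 0 from Subtype.ext abs_zero, α.endo_zero]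

/-- The sign condition matters: for `g < 0` the product formula gives `α_{-g}(a) b` instead. This is
why `A` is placed to the left of `u_g` for `g ≥ 0` and to the right for `g < 0`. -/
theorem homMul_zero_left {g : Γ} (hg : 0 ≤ g) (a b : A) : hα.homMul 0 g a b = a * b := by
  simp [homMul, hg, endo_abs_zero]

theorem homMul_zero_right {g : Γ} (hg : g < 0) (a b : A) : hα.homMul g 0 a b = a * b := by
  simp [homMul, hg, endo_abs_zero]

end EndoAction.FinelyRepresentable

/-! ### Elements `a δ_g` and gauge automorphisms of `ℓ₁(Γ, α, A)` -/

namespace L1Alg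

variable {hα : α.FinelyRepresentable}

theorem coeff_smul (c : ℂ) (a : L1Alg hα) (g : Γ) : (c • a).coeff g = c • a.coeff g := rfl

theorem coeff_star (a : L1Alg hα) (g : Γ) : (star a).coeff g = star (a.coeff (-g)) := rfl

theorem norm_eq_tsum (a : L1Alg hα) : ‖a‖ = ∑' g, ‖a.coeff g‖ := by
  have h : ‖a.1‖ = ∑' g, ‖a.coeff g‖ := by
    rw [lp.norm_eq_tsum_rpow (by simp)]
    simp [coeff]
  exact h

theorem coeff_delta_self (g : Γ) (a : α.fiber g) : (delta hα g a).coeff g = a :=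
  lp.single_apply_self _ _ _

theorem coeff_delta_of_ne {g h : Γ} (hh : h ≠ g) (a : α.fiber g) : (delta hα g a).coeff h = 0 :=
  lp.single_apply_ne _ _ _ hh

theorem coeff_delta_mul (g : Γ) (a : α.fiber g) (b : L1Alg hα) (h : Γ) :
    (delta hα g a * b).coeff h = hα.homMul g (h - g) a (b.coeff (h - g)) := by
  rw [coeff_mul, tsum_eq_single g, coeff_delta_self]
  intro k hk
  rw [coeff_delta_of_ne hk, hα.zero_homMul]

theorem hasSum_delta (a : L1Alg hα) :
    HasSum (fun g => delta hα g ⟨a.coeff g, a.coeff_mem g⟩) a := by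
  classical
  have h : HasSum (fun g => lp.single 1 g (a.coeff g)) a.1 := lp.hasSum_single (by simp) a.1
  -- The topology is by definition that of a subspace of `lp`, so the expansion into single terms,
  -- valid there because the exponent is finite, can be tested in the ambient space.
  have e : Topology.IsInducing α.l1Submodule.subtype := ⟨rfl⟩
  refine (e.hasSum_iff (fun g => delta hα g ⟨a.coeff g, a.coeff_mem g⟩) a).1 h

/-- The coefficient of the product at `g` is `a α_g(1)`, and membership in `A α_g(1)` means exactly
that this is `a`. -/
theorem delta_zero_mul_delta {g : Γ} (hg : 0 ≤ g) (a : α.fiber g) :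
    delta hα 0 ⟨a, CrossedProduct.mem_fiber_zero _⟩ *
      delta hα g ⟨α.endo (PosCone.abs g) 1, CrossedProduct.endo_one_mem_fiber g⟩ =
    delta hα g a := by
  refine ext fun h => ?_
  rw [coeff_delta_mul, sub_zero]
  by_cases hh : h = g
  · subst hh
    rw [coeff_delta_self, coeff_delta_self, hα.homMul_zero_left hg]
    exact a.2.1 hg
  · rw [coeff_delta_of_ne hh, coeff_delta_of_ne hh]
    simpa using hα.homMul_smul 0 h 0 a 0

/-- Mirror image for negative degree: the coefficient is `α_{-g}(1) a`, equal to `a` in the space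
`α_{-g}(1) A`. -/
theorem delta_mul_delta_zero {g : Γ} (hg : g < 0) (a : α.fiber g) :
    delta hα g ⟨α.endo (PosCone.abs g) 1, CrossedProduct.endo_one_mem_fiber g⟩ *
      delta hα 0 ⟨a, CrossedProduct.mem_fiber_zero _⟩ =
    delta hα g a := by
  refine ext fun h => ?_
  rw [coeff_delta_mul]
  by_cases hh : h = g
  · subst hh
    rw [sub_self, coeff_delta_self, coeff_delta_self, hα.homMul_zero_right hg]
    exact a.2.2 hg.le
  · rw [coeff_delta_of_ne (sub_ne_zero.2 hh), coeff_delta_of_ne hh]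
    simpa using hα.homMul_smul g (h - g) 0 (α.endo (PosCone.abs g) 1) 0

/-- The gauge automorphism `a_g ↦ χ(g) a_g` of `ℓ₁(Γ, α, A)` for a character `χ` of `Γ`. -/
def twist (hα : α.FinelyRepresentable) (χ : Multiplicative Γ →* Circle) :
    L1Alg hα →⋆ₙₐ[ℂ] L1Alg hα where
  toFun a := .mk (fun g => (χ (.ofAdd g) : ℂ) • a.coeff g)
    (by simpa [norm_smul, Circle.norm_coe] using a.summable_norm_coeff)
    (fun g => (α.fiber g).smul_mem _ (a.coeff_mem g))
  map_smul' c a := ext fun g => smul_comm _ _ _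
  map_zero' := ext fun g => smul_zero _
  map_add' a b := ext fun g => smul_add _ _ _
  map_mul' a b := ext fun g => by
    -- Inside the convolution sum the scalar splits as `χ(g) = χ(h) χ(g - h)`, one factor for each
    -- coefficient.
    rw [coeff_mk, coeff_mul, coeff_mul, ← tsum_const_smul'']
    refine tsum_congr fun h => ?_
    rw [coeff_mk, coeff_mk, hα.smul_homMul, hα.homMul_smul, smul_smul, ← Circle.coe_mul,
      ← map_mul, ← ofAdd_add, add_sub_cancel]
  map_star' a := ext fun g => by
    -- The conjugate of `χ(-g)` is `χ(g)`, since `χ` takes values in the unit circle.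
    rw [coeff_mk, coeff_star, coeff_star, coeff_mk, star_smul, ofAdd_neg, map_inv,
      Circle.coe_inv_eq_conj]
    simp

theorem coeff_twist (χ : Multiplicative Γ →* Circle) (a : L1Alg hα) (g : Γ) :
    (twist hα χ a).coeff g = (χ (.ofAdd g) : ℂ) • a.coeff g := rfl

theorem norm_twist (χ : Multiplicative Γ →* Circle) (a : L1Alg hα) : ‖twist hα χ a‖ = ‖a‖ := by
  simp [norm_eq_tsum, coeff_twist, norm_smul, Circle.norm_coe]

theorem twist_delta (χ : Multiplicative Γ →* Circle) (g : Γ) (a : α.fiber g) :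
    twist hα χ (delta hα g a) = (χ (.ofAdd g) : ℂ) • delta hα g a :=
  ext fun h => by
    rw [coeff_twist, coeff_smul]
    by_cases hh : h = g
    · rw [hh]
    · rw [coeff_delta_of_ne hh, smul_zero, smul_zero]

end L1Alg

/-- The composition of a representation of `ℓ₁(Γ, α, A)` with a gauge automorphism. -/
def L1Rep.twist {hα : α.FinelyRepresentable} (χ : Multiplicative Γ →* Circle) (ρ : L1Rep hα) :
    L1Rep hα where
  H := ρ.H
  toHom := ρ.toHom.comp (L1Alg.twist hα χ)
  norm_le a := (ρ.norm_le _).trans (L1Alg.norm_twist χ a).le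

/-- The endomorphism of the product of all representations that permutes the factors according to
the composition with a gauge automorphism. -/
def L1RepProd.twist (hα : α.FinelyRepresentable) (χ : Multiplicative Γ →* Circle) :
    L1RepProd hα →⋆ₙₐ[ℂ] L1RepProd hα where
  -- The entry of `f` at `ρ.twist χ` is an operator on `ρ.H` by definitional unfolding; hence the
  -- algebraic laws below hold by `rfl`.
  toFun f := ⟨fun ρ => f.1 (ρ.twist χ), memℓp_infty ⟨‖f‖, by
    rintro _ ⟨ρ, rfl⟩
    exact lp.norm_apply_le_norm ENNReal.top_ne_zero f (ρ.twist χ)⟩⟩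
  map_smul' _ _ := rfl
  map_zero' := rfl
  map_add' _ _ := rfl
  map_mul' _ _ := rfl
  map_star' _ := rfl

theorem norm_universalRep_le (hα : α.FinelyRepresentable) (a : L1Alg hα) :
    ‖universalRep hα a‖ ≤ ‖a‖ :=
  lp.norm_le_of_forall_le (norm_nonneg a) fun ρ => ρ.norm_le a

/-! ### Density, and gauge automorphisms of the crossed product -/

namespace CrossedProduct

variable {hα : α.FinelyRepresentable}

theorem continuous_ofL1 : Continuous (ofL1 hα) :=
  AddMonoidHomClass.continuous_of_bound (ofL1 hα) 1 fun a => by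
    rw [one_mul]; exact norm_universalRep_le hα a

theorem denseRange_ofL1 : DenseRange (ofL1 hα) := by
  intro b
  have e : Topology.IsInducing (fun b : CrossedProduct hα => (b.1 : L1RepProd hα)) := ⟨rfl⟩
  -- Density is checked in the ambient product, where the crossed product is the closure of the
  -- image by construction.
  rw [e.closure_eq_preimage_closure_image]
  have hb : (b.1 : L1RepProd hα) ∈ closure (Set.range (universalRep hα)) := b.2
  refine closure_mono ?_ hb
  rintro _ ⟨a, rfl⟩
  exact ⟨ofL1 hα a, ⟨a, rfl⟩, rfl⟩

/-- A closed subspace of the crossed product which contains all elements `a δ_g` is everything. -/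
theorem mem_of_isClosed (S : Submodule ℂ (CrossedProduct hα))
    (hS : IsClosed (S : Set (CrossedProduct hα)))
    (h : ∀ g (a : α.fiber g), ofL1 hα (L1Alg.delta hα g a) ∈ S) (b : CrossedProduct hα) :
    b ∈ S := by
  refine denseRange_ofL1.induction_on (p := (· ∈ S)) b hS fun a => ?_
  have ha := a.hasSum_delta.map (ofL1 hα) continuous_ofL1
  exact hS.mem_of_tendsto ha (Filter.Eventually.of_forall fun s => S.sum_mem fun g _ => h g _)

/-- `*`-homomorphisms of C*-algebras are automatically continuous, so their equalizer is a closed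
subspace. -/
theorem hom_ext {φ ψ : CrossedProduct hα →⋆ₙₐ[ℂ] CrossedProduct hα}
    (h : ∀ g (a : α.fiber g),
      φ (ofL1 hα (L1Alg.delta hα g a)) = ψ (ofL1 hα (L1Alg.delta hα g a))) : φ = ψ := by
  refine NonUnitalStarAlgHom.ext fun b => ?_
  refine mem_of_isClosed (LinearMap.eqLocus (φ : CrossedProduct hα →ₗ[ℂ] CrossedProduct hα)
    (ψ : CrossedProduct hα →ₗ[ℂ] CrossedProduct hα)) ?_ h b
  exact isClosed_eq (map_continuous φ) (map_continuous ψ)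

theorem ofL1_delta_of_nonneg {g : Γ} (hg : 0 ≤ g) (a : α.fiber g) :
    ofL1 hα (L1Alg.delta hα g a) = ofBase hα a * u hα g := by
  rw [ofBase, u, ← map_mul, L1Alg.delta_zero_mul_delta hg]

theorem ofL1_delta_of_neg {g : Γ} (hg : g < 0) (a : α.fiber g) :
    ofL1 hα (L1Alg.delta hα g a) = u hα g * ofBase hα a := by
  rw [ofBase, u, ← map_mul, L1Alg.delta_mul_delta_zero hg]

/-- The gauge endomorphism of the crossed product given by a character of `Γ`. -/
def twist (hα : α.FinelyRepresentable) (χ : Multiplicative Γ →* Circle) :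
    CrossedProduct hα →⋆ₙₐ[ℂ] CrossedProduct hα where
  toFun b := ⟨L1RepProd.twist hα χ b.1, by
    refine map_mem_closure (map_continuous (L1RepProd.twist hα χ)) b.2 ?_
    rintro _ ⟨a, rfl⟩
    exact ⟨L1Alg.twist hα χ a, rfl⟩⟩
  map_smul' _ _ := rfl
  map_zero' := rfl
  map_add' _ _ := rfl
  map_mul' _ _ := rfl
  map_star' _ := rfl

/-- At each representation `ρ` both sides are `ρ` applied to the twisted element. -/
theorem twist_ofL1 (χ : Multiplicative Γ →* Circle) (a : L1Alg hα) :
    twist hα χ (ofL1 hα a) = ofL1 hα (L1Alg.twist hα χ a) := rfl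

theorem twist_delta (χ : Multiplicative Γ →* Circle) (g : Γ) (a : α.fiber g) :
    twist hα χ (ofL1 hα (L1Alg.delta hα g a)) =
      (χ (.ofAdd g) : ℂ) • ofL1 hα (L1Alg.delta hα g a) := by
  rw [twist_ofL1, L1Alg.twist_delta, map_smul]

theorem twist_one : twist hα 1 = .id ℂ (CrossedProduct hα) :=
  hom_ext fun g a => by simp [twist_delta]

theorem twist_mul (χ ψ : Multiplicative Γ →* Circle) :
    twist hα (χ * ψ) = (twist hα χ).comp (twist hα ψ) :=
  hom_ext fun g a => by simp [twist_delta, map_smul, smul_smul, mul_comm]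

theorem twist_ofBase (χ : Multiplicative Γ →* Circle) (a : A) :
    twist hα χ (ofBase hα a) = ofBase hα a := by
  rw [ofBase, twist_delta, ofAdd_zero, map_one, Circle.coe_one, one_smul]

theorem twist_u (χ : Multiplicative Γ →* Circle) (g : Γ) :
    twist hα χ (u hα g) = (χ (.ofAdd g) : ℂ) • u hα g :=
  twist_delta χ g _

/-- A `*`-homomorphism is determined by its values on `A` and on the elements `u_g`. -/
theorem eq_twist {χ : Multiplicative Γ →* Circle} {φ : CrossedProduct hα →⋆ₙₐ[ℂ] CrossedProduct hα}
    (hA : ∀ a : A, φ (ofBase hα a) = ofBase hα a)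
    (hu : ∀ g : Γ, φ (u hα g) = (χ (.ofAdd g) : ℂ) • u hα g) : φ = twist hα χ := by
  refine hom_ext fun g a => ?_
  rcases le_or_gt 0 g with hg | hg
  · rw [ofL1_delta_of_nonneg hg, map_mul, map_mul, hA, hu, twist_ofBase, twist_u]
  · rw [ofL1_delta_of_neg hg, map_mul, map_mul, hA, hu, twist_ofBase, twist_u]

/-- The action of the characters of `Γ` by gauge automorphisms of the crossed product. -/
def dualAction (hα : α.FinelyRepresentable) :
    (Multiplicative Γ →* Circle) →* (CrossedProduct hα ≃⋆ₐ[ℂ] CrossedProduct hα) where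
  toFun χ := .ofNonUnitalStarAlgHom (twist hα χ) (twist hα χ⁻¹)
    (by rw [← twist_mul, inv_mul_cancel, twist_one])
    (by rw [← twist_mul, mul_inv_cancel, twist_one])
  map_one' := StarAlgEquiv.ext fun b => congr($twist_one b)
  map_mul' χ ψ := StarAlgEquiv.ext fun b => congr($(twist_mul χ ψ) b)

/-- The bound is uniform in `χ`, which is what lets continuity of orbit maps pass to limits. -/
theorem norm_twist_le (χ : Multiplicative Γ →* Circle) (b : CrossedProduct hα) :
    ‖twist hα χ b‖ ≤ ‖b‖ :=
  NonUnitalStarAlgHom.norm_apply_le _ b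

/-- If the characters of a family depend continuously on a parameter pointwise on `Γ`, then so do
the gauge automorphisms pointwise on the crossed product. -/
theorem continuous_twist {X : Type*} [TopologicalSpace X] (c : X → Multiplicative Γ →* Circle)
    (hc : ∀ g, Continuous fun x => c x g) (b : CrossedProduct hα) :
    Continuous fun x => twist hα (c x) b := by
  let S : Submodule ℂ (CrossedProduct hα) :=
    { carrier := {b | Continuous fun x => twist hα (c x) b}
      add_mem' := fun {a b} ha hb => by
        simp only [Set.mem_ofPred_eq, map_add] at ha hb ⊢
        exact ha.add hb
      zero_mem' := by simpa using! continuous_const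
      smul_mem' := fun r a ha => by
        simp only [Set.mem_ofPred_eq, map_smul] at ha ⊢
        exact ha.const_smul r }
  refine mem_of_isClosed S ?_ (fun g a => ?_) b
  -- If `a` is within `ε` of `b`, their orbit maps differ by less than `ε` at every parameter; thus
  -- the orbit map of `b` is a uniform limit of continuous maps.
  · refine isClosed_of_closure_subset fun b hb => ?_
    refine continuous_of_uniform_approx_of_continuous fun s hs => ?_
    obtain ⟨ε, hε, hs⟩ := Metric.mem_uniformity_dist.1 hs
    obtain ⟨a, ha, hab⟩ := Metric.mem_closure_iff.1 hb ε hε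
    refine ⟨_, ha, fun x => hs ?_⟩
    rw [dist_eq_norm, ← map_sub]
    exact (norm_twist_le _ _).trans_lt (by rwa [← dist_eq_norm])
  · change Continuous fun x => twist hα (c x) (ofL1 hα (L1Alg.delta hα g a))
    simp only [twist_delta]
    exact (continuous_subtype_val.comp (hc _)).smul continuous_const

end CrossedProduct

end DualAction

end

theorem corollary6p3 {Γ : Type v} [AddCommGroup Γ] [LinearOrder Γ] [IsOrderedAddMonoid Γ]
    [TopologicalSpace Γ] [DiscreteTopology Γ] {A : Type u} [CStarAlgebra A]
    (α : EndoAction Γ A) (hα : α.FinelyRepresentable) :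
    ∃ θ : PontryaginDual (Multiplicative Γ) →* (CrossedProduct hα ≃⋆ₐ[ℂ] CrossedProduct hα),
      (∀ χ : PontryaginDual (Multiplicative Γ),
        (∀ a : A, θ χ (CrossedProduct.ofBase hα a) = CrossedProduct.ofBase hα a) ∧
        (∀ g : Γ, θ χ (CrossedProduct.u hα g) =
          ((χ (Multiplicative.ofAdd g) : Circle) : ℂ) • CrossedProduct.u hα g) ∧
        ∀ σ : CrossedProduct hα ≃⋆ₐ[ℂ] CrossedProduct hα,
          (∀ a : A, σ (CrossedProduct.ofBase hα a) = CrossedProduct.ofBase hα a) →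
          (∀ g : Γ, σ (CrossedProduct.u hα g) =
            ((χ (Multiplicative.ofAdd g) : Circle) : ℂ) • CrossedProduct.u hα g) →
          σ = θ χ) ∧
      ∀ b : CrossedProduct hα,
        Continuous fun χ : PontryaginDual (Multiplicative Γ) => θ χ b := by
  -- The algebraic construction needs only the underlying homomorphism of a character; the topology
  -- of the dual enters only in the continuity claim.
  let r : PontryaginDual (Multiplicative Γ) →* (Multiplicative Γ →* Circle) :=
    { toFun := fun χ => (χ : Multiplicative Γ →* Circle)
      map_one' := rfl
      map_mul' := fun _ _ => rfl }
  refine ⟨(CrossedProduct.dualAction hα).comp r, fun χ => ⟨?_, ?_, fun σ hA hu => ?_⟩, fun b => ?_⟩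
  · exact CrossedProduct.twist_ofBase (r χ)
  · exact CrossedProduct.twist_u (r χ)
  · refine StarAlgEquiv.ext fun b => ?_
    exact congr($(CrossedProduct.eq_twist (χ := r χ) (φ := σ.toNonUnitalStarAlgHom) hA hu) b)
  · refine CrossedProduct.continuous_twist (fun χ => r χ) (fun g => ?_) b
    -- The dual carries the compact-open topology, for which evaluation at a point is continuous.
    have h : Continuous fun χ : Multiplicative Γ →ₜ* Circle => χ g :=
      (continuous_eval_const (F := C(Multiplicative Γ, Circle)) g).comp
        (ContinuousMonoidHom.isInducing_toContinuousMap _ _).continuous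
    exact h
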